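/- All Hilbert spaces are finite-dimensional and non-zero. A density matrix is a positive semidefinite complex matrix of trace $1$; a channel is a completely positive, trace-preserving linear map between complex matrix algebras. For a density matrix $\rho$ let $S(\rho) = -\operatorname{Tr}(\rho \log \rho)$ be its von Neumann entropy, and for a channel $\Omega$ let $$S_{\min}(\Omega) = \inf_{\rho} S(\Omega(\rho))$$ be its minimal output entropy, where the infimum runs over all density matrices $\rho$ in the domain of $\Omega$. A channel $\Phi$ is called entanglement-breaking if it has the form $$\Phi(\rho) = \sum_{k=1}^K R_k \operatorname{Tr}(X_k \rho),$$ where each $R_k$ is a density matrix and $\{X_k\}_{k=1}^K$ is a POVM, that is, $X_k \ge 0$ for all $k$ and $\sum_k X_k = I$. Theorem. Let $\Phi$ be an entanglement-breaking channel and let $\Omega$ be an arbitrary channel. Then $$S_{\min}(\Phi \otimes \Omega) = S_{\min}(\Phi) + S_{\min}(\Omega).$$ -/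

import Mathlib

open scoped ComplexOrder Kronecker

namespace QChan

/-- A density matrix (state): positive semidefinite with trace one. -/
structure IsDensityMatrix {n : Type*} [Fintype n] (ρ : Matrix n n ℂ) : Prop where
  posSemidef : ρ.PosSemidef
  trace_eq_one : ρ.trace = 1

/-- The tensor product `Φ ⊗ Ω` of two linear maps between matrix algebras: the linear extension of
`A ⊗ B ↦ Φ A ⊗ Ω B`, written out on the matrix units (see `tensorMap_kronecker`). -/
noncomputable def tensorMap {a b c d : Type*} [Fintype a] [DecidableEq a] [Fintype c]
    [DecidableEq c]
    (Φ : Matrix a a ℂ →ₗ[ℂ] Matrix b b ℂ) (Ω : Matrix c c ℂ →ₗ[ℂ] Matrix d d ℂ) :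
    Matrix (a × c) (a × c) ℂ →ₗ[ℂ] Matrix (b × d) (b × d) ℂ where
  toFun M := ∑ x : a × c, ∑ y : a × c,
    M x y • (Φ (Matrix.single x.1 y.1 1) ⊗ₖ Ω (Matrix.single x.2 y.2 1))
  map_add' M N := by simp [add_smul, Finset.sum_add_distrib]
  map_smul' r M := by simp [mul_smul, Finset.smul_sum]

/-- `Φ ⊗ Ω` sends `A ⊗ B` to `Φ A ⊗ Ω B`. -/
theorem tensorMap_kronecker {a b c d : Type*} [Fintype a] [DecidableEq a] [Fintype c]
    [DecidableEq c]
    (Φ : Matrix a a ℂ →ₗ[ℂ] Matrix b b ℂ) (Ω : Matrix c c ℂ →ₗ[ℂ] Matrix d d ℂ)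
    (A : Matrix a a ℂ) (B : Matrix c c ℂ) :
    tensorMap Φ Ω (A ⊗ₖ B) = Φ A ⊗ₖ Ω B := by
  have hA : Φ A = ∑ i, ∑ j, A i j • Φ (Matrix.single i j 1) := by
    conv_lhs => rw [Matrix.matrix_eq_sum_single A]
    simp only [map_sum, ← map_smul, Matrix.smul_single, smul_eq_mul, mul_one]
  have hB : Ω B = ∑ i, ∑ j, B i j • Ω (Matrix.single i j 1) := by
    conv_lhs => rw [Matrix.matrix_eq_sum_single B]
    simp only [map_sum, ← map_smul, Matrix.smul_single, smul_eq_mul, mul_one]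
  rw [hA, hB]
  ext ⟨p, q⟩ ⟨p', q'⟩
  simp only [tensorMap, LinearMap.coe_mk, AddHom.coe_mk, Matrix.sum_apply, Matrix.smul_apply,
    Matrix.kroneckerMap_apply, smul_eq_mul, Fintype.sum_prod_type, Finset.sum_mul_sum]
  refine Finset.sum_congr rfl fun i _ => Finset.sum_congr rfl fun k _ => ?_
  refine Finset.sum_congr rfl fun j _ => Finset.sum_congr rfl fun l _ => ?_
  ring

/-- Complete positivity: every ampliation `I_n ⊗ Φ` preserves positive semidefiniteness. -/
def IsCompletelyPositive {a b : Type*} [Fintype a] [DecidableEq a]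
    (Φ : Matrix a a ℂ →ₗ[ℂ] Matrix b b ℂ) : Prop :=
  ∀ (n : ℕ) (M : Matrix (Fin n × a) (Fin n × a) ℂ), M.PosSemidef →
    (tensorMap (LinearMap.id : Matrix (Fin n) (Fin n) ℂ →ₗ[ℂ] Matrix (Fin n) (Fin n) ℂ)
      Φ M).PosSemidef

/-- A (quantum) channel: a completely positive, trace-preserving linear map. -/
structure IsChannel {a b : Type*} [Fintype a] [DecidableEq a] [Fintype b]
    (Φ : Matrix a a ℂ →ₗ[ℂ] Matrix b b ℂ) : Prop where
  completelyPositive : IsCompletelyPositive Φ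
  trace_map : ∀ A : Matrix a a ℂ, (Φ A).trace = A.trace

/-- An entanglement-breaking channel: a channel of the form `Φ(ρ) = ∑ₖ Rₖ Tr(Xₖ ρ)` with density
matrices `Rₖ` and a POVM `{Xₖ}`. (Such a map is automatically a channel.) -/
def IsEntanglementBreaking {a b : Type*} [Fintype a] [DecidableEq a] [Fintype b]
    (Φ : Matrix a a ℂ →ₗ[ℂ] Matrix b b ℂ) : Prop :=
  ∃ (K : ℕ) (R : Fin K → Matrix b b ℂ) (X : Fin K → Matrix a a ℂ),
    (∀ k, IsDensityMatrix (R k)) ∧ (∀ k, (X k).PosSemidef) ∧ ∑ k, X k = 1 ∧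
    ∀ ρ : Matrix a a ℂ, Φ ρ = ∑ k, (X k * ρ).trace • R k

/-- The von Neumann entropy `S(ρ) = -Tr(ρ log ρ)`, with `log` applied through the functional
calculus (the convention `0 log 0 = 0` holds because `Real.log 0 = 0`). -/
noncomputable def vonNeumannEntropy {n : Type*} [Fintype n] [DecidableEq n]
    (ρ : Matrix n n ℂ) : ℝ :=
  -(ρ * cfc Real.log ρ).trace.re

/-- The minimal output entropy `S_min(Ω) = inf_ρ S(Ω(ρ))` over all density matrices `ρ` in the
domain of `Ω`. -/
noncomputable def minEntropy {a b : Type*} [Fintype a] [Fintype b] [DecidableEq b]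
    (Ω : Matrix a a ℂ →ₗ[ℂ] Matrix b b ℂ) : ℝ :=
  sInf ((fun ρ : Matrix a a ℂ => vonNeumannEntropy (Ω ρ)) '' {ρ | IsDensityMatrix ρ})

end QChan

/-! Product inputs give `≤`, since entropy is additive on product states. For `≥`, an
entanglement-breaking `Φ` turns any bipartite `ρ` into a separable output `∑ pₖ Rₖ ⊗ Ω σₖ` with `∑
pₖ Rₖ = Φ τ`, where `τ` is the first marginal of `ρ`. So it suffices that `S(∑ pₖ Rₖ ⊗ Tₖ) ≥ S(∑ pₖ
Rₖ) + ∑ pₖ S(Tₖ)` (`le_vonNeumannEntropy_sum_kronecker`). Writing Holevo quantities as average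
relative entropies, this says that discarding the factors `Tₖ` cannot increase the Holevo quantity,
which is monotonicity of relative entropy under partial trace (`relEntropy_le_of_marginal`).

Monotonicity rests on writing `D(A‖B) - Tr A + Tr B` as an integral over `t > 0`, with positive
weight, of `⟨A - B, (L_A + t R_B)⁻¹ (A - B)⟩`. Each such form is a supremum over `X` of a functional
linear in `(A, B)`; restricting to `X ⊗ 1` yields exactly the form of the marginals, which is
therefore no larger. -/

namespace QChan

open Matrix MeasureTheory Set Filter Topology

/-! ### Monotonicity of relative entropy under partial trace. -/

section RelativeEntropy

variable {n m : Type*} [Fintype n] [DecidableEq n] [Fintype m] [DecidableEq m]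

/-- Integral representation of the scalar relative entropy, with integrability. -/
theorem integral_relEntropy_scalar {a b : ℝ} (ha : 0 ≤ a) (hb : 0 < b) :
    IntegrableOn (fun t : ℝ => (a - b) ^ 2 / (a + t * b) * (t / (1 + t) ^ 2)) (Ioi 0) ∧
    ∫ t in Ioi (0 : ℝ), (a - b) ^ 2 / (a + t * b) * (t / (1 + t) ^ 2) =
      a * Real.log a - a * Real.log b - a + b := by
  -- An antiderivative found by partial fractions; the integral is its limit `-a log b` at infinity
  -- minus `G 0`.
  set G : ℝ → ℝ := fun t => a * (Real.log (1 + t) - Real.log (a + t * b)) + (a - b) / (1 + t)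
  have hcont : ContinuousWithinAt G (Ici 0) 0 := by
    have h2 : ContinuousAt (fun t : ℝ => (a - b) / (1 + t)) 0 :=
      ContinuousAt.div (by fun_prop) (by fun_prop) (by norm_num)
    have h1 : ContinuousAt (fun t : ℝ => a * (Real.log (1 + t) - Real.log (a + t * b))) 0 := by
      rcases ha.eq_or_lt with rfl | ha
      -- For `a = 0` the logarithm is singular at `0`, but its prefactor vanishes.
      · simpa using continuousAt_const
      · refine continuousAt_const.mul (ContinuousAt.sub ?_ ?_)
        · exact ContinuousAt.log (by fun_prop) (by norm_num)
        · exact ContinuousAt.log (by fun_prop) (by simpa using ha.ne')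
    exact (h1.add h2).continuousWithinAt
  have hderiv : ∀ t ∈ Ioi (0 : ℝ),
      HasDerivAt G ((a - b) ^ 2 / (a + t * b) * (t / (1 + t) ^ 2)) t := by
    intro t ht
    have ht : 0 < t := ht
    have h1 : 1 + t ≠ 0 := by positivity
    have h2 : a + t * b ≠ 0 := by positivity
    have d1 : HasDerivAt (fun t : ℝ => 1 + t) 1 t := (hasDerivAt_id t).const_add 1
    have d2 : HasDerivAt (fun t : ℝ => a + t * b) b t := by
      simpa using ((hasDerivAt_id t).mul_const b).const_add a
    have := (((d1.log h1).sub (d2.log h2)).const_mul a).add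
      ((hasDerivAt_const t (a - b)).div d1 h1)
    refine this.congr_deriv ?_
    field_simp
    ring
  have hpos : ∀ t ∈ Ioi (0 : ℝ), 0 ≤ (a - b) ^ 2 / (a + t * b) * (t / (1 + t) ^ 2) := by
    intro t ht
    have ht : 0 < t := ht
    positivity
  have hlim : Tendsto G atTop (𝓝 (-(a * Real.log b))) := by
    have e : ∀ᶠ t : ℝ in atTop,
        a * Real.log ((t⁻¹ + 1) / (a * t⁻¹ + b)) + (a - b) / (1 + t) = G t := by
      filter_upwards [eventually_gt_atTop 0] with t ht
      have h2 : a + t * b ≠ 0 := by positivity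
      have : (t⁻¹ + 1) / (a * t⁻¹ + b) = (1 + t) / (a + t * b) := by
        have : a * t⁻¹ + b ≠ 0 := by positivity
        field_simp
      rw [this, Real.log_div (by positivity) h2]
    refine Tendsto.congr' e ?_
    have i : Tendsto (fun t : ℝ => t⁻¹) atTop (𝓝 0) := tendsto_inv_atTop_zero
    have l1 : Tendsto (fun t : ℝ => (t⁻¹ + 1) / (a * t⁻¹ + b)) atTop
        (𝓝 ((0 + 1) / (a * 0 + b))) :=
      (i.add_const 1).div ((i.const_mul a).add_const b) (by simpa using hb.ne')
    have l2 : Tendsto (fun t : ℝ => (a - b) / (1 + t)) atTop (𝓝 0) :=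
      tendsto_const_nhds.div_atTop (tendsto_atTop_add_const_left _ 1 tendsto_id)
    have := ((l1.log (by simpa using hb.ne')).const_mul a).add l2
    simpa [Real.log_inv] using this
  refine ⟨integrableOn_Ioi_deriv_of_nonneg hcont hderiv hpos hlim, ?_⟩
  rw [integral_Ioi_of_hasDerivAt_of_nonneg hcont hderiv hpos hlim]
  simp [G]
  ring

theorem trace_conj_diagonal_mul (U V : Matrix n n ℂ) (a b : n → ℝ) :
    ((U * diagonal (fun i => (a i : ℂ)) * Uᴴ) * (V * diagonal (fun i => (b i : ℂ)) * Vᴴ)).trace =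
      ((∑ i, ∑ j, a i * b j * Complex.normSq ((Uᴴ * V) i j) : ℝ) : ℂ) := by
  have : ((U * diagonal (fun i => (a i : ℂ)) * Uᴴ) *
      (V * diagonal (fun i => (b i : ℂ)) * Vᴴ)).trace =
      ((diagonal (fun i => (a i : ℂ)) * (Uᴴ * V)) *
        (diagonal (fun i => (b i : ℂ)) * (Uᴴ * V)ᴴ)).trace := by
    rw [conjTranspose_mul, conjTranspose_conjTranspose]
    simp only [Matrix.mul_assoc]
    rw [trace_mul_comm]
    simp only [Matrix.mul_assoc]
  rw [this, Matrix.trace]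
  push_cast
  refine Finset.sum_congr rfl fun i _ => ?_
  rw [diag_apply, Matrix.mul_apply]
  refine Finset.sum_congr rfl fun j _ => ?_
  rw [diagonal_mul, diagonal_mul, conjTranspose_apply, Complex.normSq_eq_conj_mul_self]
  simp only [RCLike.star_def]
  ring

/-- The concave quadratic functional of `X` whose supremum is the resolvent quadratic form
`⟨A - B, (L_A + t R_B)⁻¹ (A - B)⟩`. -/
noncomputable def resolventForm (t : ℝ) (A B X : Matrix n n ℂ) : ℝ :=
  2 * ((A - B) * Xᴴ).trace.re - (A * (X * Xᴴ)).trace.re - t * (B * (Xᴴ * X)).trace.re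

/-- In the coordinates `Z = Uᴴ X V` the functional decouples into one scalar quadratic per pair of
eigenvectors. -/
theorem resolventForm_conj {U V : Matrix n n ℂ} (hU : Uᴴ * U = 1) (hV : Vᴴ * V = 1)
    (a b : n → ℝ) (t : ℝ) (Z : Matrix n n ℂ) :
    resolventForm t (U * diagonal (fun i => (a i : ℂ)) * Uᴴ)
      (V * diagonal (fun i => (b i : ℂ)) * Vᴴ) (U * Z * Vᴴ) =
    ∑ i, ∑ j, (2 * (a i - b j) * ((Uᴴ * V) i j * star (Z i j)).re
      - (a i + t * b j) * Complex.normSq (Z i j)) := by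
  set da := diagonal (fun i => (a i : ℂ)) with hda
  set db := diagonal (fun i => (b i : ℂ)) with hdb
  have hU' : ∀ M : Matrix n n ℂ, Uᴴ * (U * M) = M := fun M => by
    rw [← Matrix.mul_assoc, hU, Matrix.one_mul]
  have hV' : ∀ M : Matrix n n ℂ, Vᴴ * (V * M) = M := fun M => by
    rw [← Matrix.mul_assoc, hV, Matrix.one_mul]
  have e1 : ((U * da * Uᴴ - V * db * Vᴴ) * (U * Z * Vᴴ)ᴴ).trace
      = ((da * (Uᴴ * V) - (Uᴴ * V) * db) * Zᴴ).trace := by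
    simp only [conjTranspose_mul, conjTranspose_conjTranspose, Matrix.sub_mul, trace_sub,
      Matrix.mul_assoc]
    congr 1
    · rw [trace_mul_comm]
      simp only [Matrix.mul_assoc]
      rw [hU]
      simp
    · rw [hV', ← Matrix.mul_assoc V, ← Matrix.mul_assoc (V * db), trace_mul_comm]
      simp only [Matrix.mul_assoc]
  have e2 : ((U * da * Uᴴ) * ((U * Z * Vᴴ) * (U * Z * Vᴴ)ᴴ)).trace = (da * (Z * Zᴴ)).trace := by
    simp only [conjTranspose_mul, conjTranspose_conjTranspose, Matrix.mul_assoc, hU', hV']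
    rw [trace_mul_comm]
    simp only [Matrix.mul_assoc, hU, Matrix.mul_one]
  have e3 : ((V * db * Vᴴ) * ((U * Z * Vᴴ)ᴴ * (U * Z * Vᴴ))).trace = (db * (Zᴴ * Z)).trace := by
    simp only [conjTranspose_mul, conjTranspose_conjTranspose, Matrix.mul_assoc, hU', hV']
    rw [trace_mul_comm]
    simp only [Matrix.mul_assoc, hV, Matrix.mul_one]
  rw [resolventForm, e1, e2, e3]
  have f1 : ((da * (Uᴴ * V) - (Uᴴ * V) * db) * Zᴴ).trace.re
      = ∑ i, ∑ j, (a i - b j) * ((Uᴴ * V) i j * star (Z i j)).re := by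
    rw [Matrix.trace, Complex.re_sum]
    refine Finset.sum_congr rfl fun i _ => ?_
    rw [diag_apply, Matrix.mul_apply, Complex.re_sum]
    refine Finset.sum_congr rfl fun j _ => ?_
    rw [Matrix.sub_apply, hda, hdb, diagonal_mul, mul_diagonal, conjTranspose_apply, ← Complex.re_ofReal_mul]
    push_cast
    congr 1
    ring
  have f2 : (da * (Z * Zᴴ)).trace.re = ∑ i, ∑ j, a i * Complex.normSq (Z i j) := by
    rw [Matrix.trace, Complex.re_sum]
    refine Finset.sum_congr rfl fun i _ => ?_
    rw [diag_apply, hda, diagonal_mul, Complex.re_ofReal_mul, Matrix.mul_apply, Complex.re_sum,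
      Finset.mul_sum]
    refine Finset.sum_congr rfl fun j _ => ?_
    rw [conjTranspose_apply, RCLike.star_def, Complex.mul_conj, Complex.ofReal_re]
  have f3 : (db * (Zᴴ * Z)).trace.re = ∑ i, ∑ j, b j * Complex.normSq (Z i j) := by
    rw [Finset.sum_comm, Matrix.trace, Complex.re_sum]
    refine Finset.sum_congr rfl fun i _ => ?_
    rw [diag_apply, hdb, diagonal_mul, Complex.re_ofReal_mul, Matrix.mul_apply, Complex.re_sum,
      Finset.mul_sum]
    refine Finset.sum_congr rfl fun j _ => ?_
    rw [conjTranspose_apply, RCLike.star_def, mul_comm (starRingEnd ℂ _), Complex.mul_conj,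
      Complex.ofReal_re]
  rw [f1, f2, f3]
  simp only [Finset.mul_sum, ← Finset.sum_sub_distrib]
  refine Finset.sum_congr rfl fun i _ => Finset.sum_congr rfl fun j _ => ?_
  ring

/-- Complete the square in `z`. If `s = 0`, the linear term vanishes too and `k ^ 2 / 0 = 0` is the
right value. -/
theorem scalar_resolvent_le {k s : ℝ} (hs : 0 ≤ s) (hk : s = 0 → k = 0) (w z : ℂ) :
    2 * k * (w * star z).re - s * Complex.normSq z ≤ Complex.normSq w * (k ^ 2 / s) := by
  rcases hs.eq_or_lt with rfl | hs
  · simp [hk rfl]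
  · rw [← mul_div_assoc, le_div_iff₀ hs]
    simp only [Complex.normSq_apply, RCLike.star_def, Complex.mul_re, Complex.conj_re,
      Complex.conj_im]
    nlinarith [sq_nonneg (k * w.re - s * z.re), sq_nonneg (k * w.im - s * z.im)]

theorem scalar_resolvent_eq {k s : ℝ} (w : ℂ) :
    2 * k * (w * star (((k / s : ℝ) : ℂ) * w)).re - s * Complex.normSq (((k / s : ℝ) : ℂ) * w)
      = Complex.normSq w * (k ^ 2 / s) := by
  rcases eq_or_ne s 0 with rfl | hs
  · simp
  · simp only [Complex.normSq_apply, RCLike.star_def, Complex.mul_re, Complex.conj_re,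
      Complex.conj_im, Complex.ofReal_re, Complex.ofReal_im, Complex.mul_im]
    field_simp
    ring

/-- The resolvent quadratic form `⟨A - B, (L_A + t R_B)⁻¹ (A - B)⟩` in eigenbases of `A = U a Uᴴ`
and `B = V b Vᴴ`. -/
noncomputable def resolventSum (W : Matrix n n ℂ) (a b : n → ℝ) (t : ℝ) : ℝ :=
  ∑ i, ∑ j, Complex.normSq (W i j) * ((a i - b j) ^ 2 / (a i + t * b j))

theorem resolventForm_le {U V : Matrix n n ℂ} (hU : Uᴴ * U = 1) (hV : Vᴴ * V = 1)
    {a b : n → ℝ} (ha : ∀ i, 0 ≤ a i) (hb : ∀ i, 0 ≤ b i) {t : ℝ} (ht : 0 < t)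
    (X : Matrix n n ℂ) :
    resolventForm t (U * diagonal (fun i => (a i : ℂ)) * Uᴴ)
      (V * diagonal (fun i => (b i : ℂ)) * Vᴴ) X ≤ resolventSum (Uᴴ * V) a b t := by
  have hX : X = U * (Uᴴ * X * V) * Vᴴ := by
    simp only [Matrix.mul_assoc, mul_eq_one_comm.1 hV, Matrix.mul_one]
    rw [← Matrix.mul_assoc, mul_eq_one_comm.1 hU, Matrix.one_mul]
  rw [hX, resolventForm_conj hU hV, resolventSum]
  refine Finset.sum_le_sum fun i _ => Finset.sum_le_sum fun j _ => ?_
  have h1 := ha i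
  have h2 := mul_nonneg ht.le (hb j)
  refine scalar_resolvent_le (add_nonneg h1 h2) (fun h => ?_) _ _
  have h3 : a i = 0 := by linarith
  have h4 : t * b j = 0 := by linarith
  rw [h3, (mul_eq_zero.1 h4).resolve_left ht.ne', sub_zero]

theorem exists_resolventForm_eq {U V : Matrix n n ℂ} (hU : Uᴴ * U = 1) (hV : Vᴴ * V = 1)
    (a b : n → ℝ) (t : ℝ) :
    ∃ X, resolventForm t (U * diagonal (fun i => (a i : ℂ)) * Uᴴ)
      (V * diagonal (fun i => (b i : ℂ)) * Vᴴ) X = resolventSum (Uᴴ * V) a b t := by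
  -- The entrywise maximiser `z = (k / s) w` of the scalar quadratics.
  refine ⟨U * (Matrix.of fun i j =>
    (((a i - b j) / (a i + t * b j) : ℝ) : ℂ) * (Uᴴ * V) i j) * Vᴴ, ?_⟩
  rw [resolventForm_conj hU hV, resolventSum]
  exact Finset.sum_congr rfl fun i _ => Finset.sum_congr rfl fun j _ => scalar_resolvent_eq _

omit [DecidableEq n] in
-- Products of `X ⊗ 1` and its adjoint keep the form `Y ⊗ 1`, so every trace sees only the
-- marginals.
theorem resolventForm_kronecker_one {A B : Matrix (n × m) (n × m) ℂ} {A' B' : Matrix n n ℂ}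
    (hA : ∀ Y : Matrix n n ℂ, (A * (Y ⊗ₖ (1 : Matrix m m ℂ))).trace = (A' * Y).trace)
    (hB : ∀ Y : Matrix n n ℂ, (B * (Y ⊗ₖ (1 : Matrix m m ℂ))).trace = (B' * Y).trace)
    (t : ℝ) (X : Matrix n n ℂ) :
    resolventForm t A B (X ⊗ₖ (1 : Matrix m m ℂ)) = resolventForm t A' B' X := by
  simp only [resolventForm, conjTranspose_kronecker, conjTranspose_one, ← mul_kronecker_mul,
    Matrix.one_mul, Matrix.sub_mul, trace_sub, hA, hB]

/-- The Umegaki relative entropy `Tr A log A - Tr A log B`. -/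
noncomputable def relEntropy (A B : Matrix n n ℂ) : ℝ :=
  (A * cfc Real.log A).trace.re - (A * cfc Real.log B).trace.re

theorem _root_.Matrix.IsHermitian.eq_conj_diagonal {A : Matrix n n ℂ} (hA : A.IsHermitian) :
    A = (hA.eigenvectorUnitary : Matrix n n ℂ) * diagonal (fun i => (hA.eigenvalues i : ℂ)) *
      (hA.eigenvectorUnitary : Matrix n n ℂ)ᴴ := by
  conv_lhs => rw [hA.spectral_theorem]
  rfl

theorem _root_.Matrix.IsHermitian.cfc_eq_conj_diagonal {A : Matrix n n ℂ} (hA : A.IsHermitian)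
    (f : ℝ → ℝ) :
    cfc f A = (hA.eigenvectorUnitary : Matrix n n ℂ) *
      diagonal (fun i => ((f (hA.eigenvalues i) : ℝ) : ℂ)) *
      (hA.eigenvectorUnitary : Matrix n n ℂ)ᴴ := by
  rw [hA.cfc_eq]
  rfl

theorem _root_.Matrix.IsHermitian.conjTranspose_eigenvectorUnitary_mul {A : Matrix n n ℂ}
    (hA : A.IsHermitian) :
    (hA.eigenvectorUnitary : Matrix n n ℂ)ᴴ * (hA.eigenvectorUnitary : Matrix n n ℂ) = 1 :=
  Unitary.coe_star_mul_self hA.eigenvectorUnitary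

theorem trace_mul_cfc_self {A : Matrix n n ℂ} (hA : A.IsHermitian) (f : ℝ → ℝ) :
    (A * cfc f A).trace = ((∑ i, hA.eigenvalues i * f (hA.eigenvalues i) : ℝ) : ℂ) := by
  rw [hA.cfc_eq_conj_diagonal f]
  conv_lhs => enter [1, 1]; rw [hA.eq_conj_diagonal]
  rw [trace_conj_diagonal_mul, hA.conjTranspose_eigenvectorUnitary_mul]
  congr 1
  refine Finset.sum_congr rfl fun i _ => ?_
  rw [Finset.sum_eq_single i] <;> simp +contextual [eq_comm]

theorem sum_normSq_row {W : Matrix n n ℂ} (hW : W * Wᴴ = 1) (i : n) :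
    ∑ j, Complex.normSq (W i j) = 1 := by
  have := congrFun (congrFun hW i) i
  rw [Matrix.mul_apply, Matrix.one_apply_eq] at this
  have h := congrArg Complex.re this
  simpa [Complex.mul_conj, -Complex.mul_re] using h

/-- If `V b Vᴴ` dominates a positive multiple of `U a Uᴴ`, its kernel lies in that of `U a Uᴴ`. -/
theorem normSq_eq_zero_or_of_dominated {U V : Matrix n n ℂ} (hV : Vᴴ * V = 1) {a b : n → ℝ}
    (ha : ∀ i, 0 ≤ a i) {p : ℝ} (hp : 0 < p)
    (h : (V * diagonal (fun i => (b i : ℂ)) * Vᴴ -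
      (p : ℂ) • (U * diagonal (fun i => (a i : ℂ)) * Uᴴ)).PosSemidef)
    (i j : n) (hj : b j = 0) : Complex.normSq ((Uᴴ * V) i j) = 0 ∨ a i = 0 := by
  -- The `j`-th diagonal entry in the eigenbasis `V` reads `b j - p ∑ᵢ a i |W i j|² ≥ 0`; at `b j =
  -- 0` every summand must vanish.
  have h := (h.conjTranspose_mul_mul_same V).diag_nonneg (i := j)
  have e : Vᴴ * (V * diagonal (fun i => (b i : ℂ)) * Vᴴ -
      (p : ℂ) • (U * diagonal (fun i => (a i : ℂ)) * Uᴴ)) * V =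
      diagonal (fun i => (b i : ℂ)) -
        (p : ℂ) • ((Uᴴ * V)ᴴ * diagonal (fun i => (a i : ℂ)) * (Uᴴ * V)) := by
    rw [Matrix.mul_sub, Matrix.sub_mul]
    congr 1
    · simp only [Matrix.mul_assoc, hV, Matrix.mul_one]
      rw [← Matrix.mul_assoc, hV, Matrix.one_mul]
    · rw [Matrix.mul_smul, Matrix.smul_mul, conjTranspose_mul, conjTranspose_conjTranspose]
      simp only [Matrix.mul_assoc]
  rw [e] at h
  generalize Uᴴ * V = W at h ⊢
  have e2 : (Wᴴ * diagonal (fun i => (a i : ℂ)) * W) j j =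
      ((∑ i, a i * Complex.normSq (W i j) : ℝ) : ℂ) := by
    rw [Matrix.mul_apply]
    push_cast
    refine Finset.sum_congr rfl fun i _ => ?_
    rw [mul_diagonal, conjTranspose_apply, Complex.normSq_eq_conj_mul_self]
    simp only [RCLike.star_def]
    ring
  rw [Matrix.sub_apply, Matrix.smul_apply, e2, diagonal_apply_eq, hj, smul_eq_mul,
    ← Complex.ofReal_mul, ← Complex.ofReal_sub, Complex.zero_le_real] at h
  have hsum : ∑ i, a i * Complex.normSq (W i j) ≤ 0 := by
    by_contra hc
    have := mul_pos hp (not_le.1 hc)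
    linarith
  have h0 : ∀ i ∈ Finset.univ, 0 ≤ a i * Complex.normSq (W i j) := fun i _ =>
    mul_nonneg (ha i) (Complex.normSq_nonneg _)
  have := (Finset.sum_eq_zero_iff_of_nonneg h0).1 (le_antisymm hsum (Finset.sum_nonneg h0)) i
    (Finset.mem_univ i)
  exact (mul_eq_zero.1 this).symm

omit [DecidableEq n] in
-- Integrate term by term. The support condition is essential: for `b j = 0 < a i` the integrand `a
-- i * t / (1 + t) ^ 2` diverges logarithmically, so such a pair must carry weight zero.
theorem integral_resolventSum {W : Matrix n n ℂ} {a b : n → ℝ} (ha : ∀ i, 0 ≤ a i)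
    (hb : ∀ i, 0 ≤ b i) (supp : ∀ i j, b j = 0 → Complex.normSq (W i j) = 0 ∨ a i = 0) :
    IntegrableOn (fun t => resolventSum W a b t * (t / (1 + t) ^ 2)) (Ioi 0) ∧
      ∫ t in Ioi (0 : ℝ), resolventSum W a b t * (t / (1 + t) ^ 2) =
        ∑ i, ∑ j, Complex.normSq (W i j) *
          (a i * Real.log (a i) - a i * Real.log (b j) - a i + b j) := by
  have term : ∀ i j,
      IntegrableOn (fun t : ℝ => Complex.normSq (W i j) *
        ((a i - b j) ^ 2 / (a i + t * b j) * (t / (1 + t) ^ 2))) (Ioi 0) ∧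
      ∫ t in Ioi (0 : ℝ), Complex.normSq (W i j) *
        ((a i - b j) ^ 2 / (a i + t * b j) * (t / (1 + t) ^ 2)) =
      Complex.normSq (W i j) *
        (a i * Real.log (a i) - a i * Real.log (b j) - a i + b j) := by
    intro i j
    rcases (hb j).eq_or_lt with hj | hj
    · rcases supp i j hj.symm with h | h
      · simp [h]
      · simp [h, ← hj]
    · obtain ⟨h1, h2⟩ := integral_relEntropy_scalar (ha i) hj
      exact ⟨h1.const_mul _, by rw [integral_const_mul, h2]⟩
  simp only [resolventSum, Finset.sum_mul, mul_assoc]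
  have hint : ∀ i, IntegrableOn (fun t => ∑ j, Complex.normSq (W i j) *
      ((a i - b j) ^ 2 / (a i + t * b j) * (t / (1 + t) ^ 2))) (Ioi 0) := fun i =>
    integrable_finsetSum _ fun j _ => (term i j).1
  refine ⟨integrable_finsetSum _ fun i _ => hint i, ?_⟩
  rw [integral_finsetSum _ fun i _ => hint i]
  refine Finset.sum_congr rfl fun i _ => ?_
  rw [integral_finsetSum _ fun j _ => (term i j).1]
  exact Finset.sum_congr rfl fun j _ => (term i j).2

/-- The weights `|W i j|²` are doubly stochastic, so terms depending on one index collapse to plain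
sums. -/
theorem sum_normSq_mul_relEntropy {W : Matrix n n ℂ} (hW : W * Wᴴ = 1) (a b : n → ℝ) :
    ∑ i, ∑ j, Complex.normSq (W i j) *
      (a i * Real.log (a i) - a i * Real.log (b j) - a i + b j) =
    ∑ i, a i * Real.log (a i) - ∑ i, ∑ j, a i * Real.log (b j) * Complex.normSq (W i j)
      - ∑ i, a i + ∑ j, b j := by
  have hW' : Wᴴ * (Wᴴ)ᴴ = 1 := by
    rw [conjTranspose_conjTranspose]; exact mul_eq_one_comm.1 hW
  have hcol : ∀ j, ∑ i, Complex.normSq (W i j) = 1 := fun j => by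
    simpa using sum_normSq_row hW' j
  have s1 : ∑ i, ∑ j, Complex.normSq (W i j) * (a i * Real.log (a i)) =
      ∑ i, a i * Real.log (a i) := Finset.sum_congr rfl fun i _ => by
    rw [← Finset.sum_mul, sum_normSq_row hW, one_mul]
  have s2 : ∑ i, ∑ j, Complex.normSq (W i j) * a i = ∑ i, a i :=
    Finset.sum_congr rfl fun i _ => by rw [← Finset.sum_mul, sum_normSq_row hW, one_mul]
  have s3 : ∑ i, ∑ j, Complex.normSq (W i j) * b j = ∑ j, b j := by
    rw [Finset.sum_comm]
    exact Finset.sum_congr rfl fun i _ => by rw [← Finset.sum_mul, hcol, one_mul]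
  rw [← s1, ← s2, ← s3]
  simp only [← Finset.sum_sub_distrib, ← Finset.sum_add_distrib]
  exact Finset.sum_congr rfl fun i _ => Finset.sum_congr rfl fun j _ => by ring

/-- Trace of `A f(B)` in eigenbases. -/
theorem trace_mul_cfc {A B : Matrix n n ℂ} (hA : A.IsHermitian) (hB : B.IsHermitian)
    (f : ℝ → ℝ) :
    (A * cfc f B).trace = ((∑ i, ∑ j, hA.eigenvalues i * f (hB.eigenvalues j) *
      Complex.normSq (((hA.eigenvectorUnitary : Matrix n n ℂ)ᴴ *
        (hB.eigenvectorUnitary : Matrix n n ℂ)) i j) : ℝ) : ℂ) := by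
  rw [hB.cfc_eq_conj_diagonal f]
  conv_lhs => enter [1, 1]; rw [hA.eq_conj_diagonal]
  rw [trace_conj_diagonal_mul]

/-- Integral representation of the relative entropy of `A` with respect to an operator `B`
dominating a positive multiple of `A`, in terms of resolvent quadratic forms. -/
theorem integral_resolventSum_eq_relEntropy {A B : Matrix n n ℂ} (hA : A.PosSemidef)
    (hB : B.PosSemidef) {p : ℝ} (hp : 0 < p) (hAB : (B - (p : ℂ) • A).PosSemidef) :
    IntegrableOn (fun t => resolventSum ((hA.1.eigenvectorUnitary : Matrix n n ℂ)ᴴ *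
      (hB.1.eigenvectorUnitary : Matrix n n ℂ)) hA.1.eigenvalues hB.1.eigenvalues t *
        (t / (1 + t) ^ 2)) (Ioi 0) ∧
      ∫ t in Ioi (0 : ℝ), resolventSum ((hA.1.eigenvectorUnitary : Matrix n n ℂ)ᴴ *
      (hB.1.eigenvectorUnitary : Matrix n n ℂ)) hA.1.eigenvalues hB.1.eigenvalues t *
        (t / (1 + t) ^ 2) =
        relEntropy A B - A.trace.re + B.trace.re := by
  have hU := hA.1.conjTranspose_eigenvectorUnitary_mul
  have hV := hB.1.conjTranspose_eigenvectorUnitary_mul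
  have supp := fun i j => normSq_eq_zero_or_of_dominated
    (U := (hA.1.eigenvectorUnitary : Matrix n n ℂ)) (a := hA.1.eigenvalues)
    (b := hB.1.eigenvalues) hV hA.eigenvalues_nonneg hp
    (by rwa [← hA.1.eq_conj_diagonal, ← hB.1.eq_conj_diagonal]) i j
  have hW : ((hA.1.eigenvectorUnitary : Matrix n n ℂ)ᴴ *
      (hB.1.eigenvectorUnitary : Matrix n n ℂ)) *
      ((hA.1.eigenvectorUnitary : Matrix n n ℂ)ᴴ *
      (hB.1.eigenvectorUnitary : Matrix n n ℂ))ᴴ = 1 := by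
    rw [conjTranspose_mul, conjTranspose_conjTranspose, Matrix.mul_assoc,
      ← Matrix.mul_assoc (hB.1.eigenvectorUnitary : Matrix n n ℂ), mul_eq_one_comm.1 hV,
      Matrix.one_mul, hU]
  have main := integral_resolventSum hA.eigenvalues_nonneg hB.eigenvalues_nonneg supp
  refine ⟨main.1, main.2.trans ?_⟩
  have tA : A.trace.re = ∑ i, hA.1.eigenvalues i := by
    rw [hA.1.trace_eq_sum_eigenvalues, Complex.re_sum]; rfl
  have tB : B.trace.re = ∑ j, hB.1.eigenvalues j := by
    rw [hB.1.trace_eq_sum_eigenvalues, Complex.re_sum]; rfl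
  rw [sum_normSq_mul_relEntropy hW, relEntropy, trace_mul_cfc_self hA.1, Complex.ofReal_re,
    trace_mul_cfc hA.1 hB.1, Complex.ofReal_re, tA, tB]

/-- Monotonicity of the relative entropy under partial trace. -/
theorem relEntropy_le_of_marginal {A B : Matrix (n × m) (n × m) ℂ} {A' B' : Matrix n n ℂ}
    (hA : A.PosSemidef) (hB : B.PosSemidef) (hA' : A'.PosSemidef) (hB' : B'.PosSemidef)
    (mA : ∀ Y : Matrix n n ℂ, (A * (Y ⊗ₖ (1 : Matrix m m ℂ))).trace = (A' * Y).trace)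
    (mB : ∀ Y : Matrix n n ℂ, (B * (Y ⊗ₖ (1 : Matrix m m ℂ))).trace = (B' * Y).trace)
    {p : ℝ} (hp : 0 < p) (hAB : (B - (p : ℂ) • A).PosSemidef)
    (hAB' : (B' - (p : ℂ) • A').PosSemidef) :
    relEntropy A' B' ≤ relEntropy A B := by
  obtain ⟨i1, e1⟩ := integral_resolventSum_eq_relEntropy hA hB hp hAB
  obtain ⟨i2, e2⟩ := integral_resolventSum_eq_relEntropy hA' hB' hp hAB'
  have tA : A.trace = A'.trace := by simpa using mA 1
  have tB : B.trace = B'.trace := by simpa using mB 1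
  have key := setIntegral_mono_on i2 i1 measurableSet_Ioi fun t ht => by
    have ht : (0 : ℝ) < t := ht
    refine mul_le_mul_of_nonneg_right ?_ (by positivity)
    -- The optimal `X` for the marginals gives the competitor `X ⊗ 1` for `A` and `B`.
    obtain ⟨X, hX⟩ := exists_resolventForm_eq hA'.1.conjTranspose_eigenvectorUnitary_mul
      hB'.1.conjTranspose_eigenvectorUnitary_mul hA'.1.eigenvalues hB'.1.eigenvalues t
    rw [← hA'.1.eq_conj_diagonal, ← hB'.1.eq_conj_diagonal,
      ← resolventForm_kronecker_one mA mB] at hX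
    rw [← hX]
    have := resolventForm_le hA.1.conjTranspose_eigenvectorUnitary_mul
      hB.1.conjTranspose_eigenvectorUnitary_mul hA.eigenvalues_nonneg hB.eigenvalues_nonneg ht
      (X ⊗ₖ (1 : Matrix m m ℂ))
    rwa [← hA.1.eq_conj_diagonal, ← hB.1.eq_conj_diagonal] at this
  rw [e1, e2, tA, tB] at key
  linarith

end RelativeEntropy

/-! ### Entropy of product and separable states. -/

section Entropy

variable {n m : Type*} [Fintype n] [DecidableEq n] [Fintype m] [DecidableEq m]

theorem vonNeumannEntropy_eq_sum_eigenvalues {A : Matrix n n ℂ} (hA : A.IsHermitian) :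
    vonNeumannEntropy A = ∑ i, Real.negMulLog (hA.eigenvalues i) := by
  rw [vonNeumannEntropy, trace_mul_cfc_self hA, Complex.ofReal_re, ← Finset.sum_neg_distrib]
  simp [Real.negMulLog]

/-- The entropy of a Hermitian matrix can be read off any factorization of its
characteristic polynomial. -/
theorem vonNeumannEntropy_eq_sum_of_charpoly {A : Matrix n n ℂ} (hA : A.IsHermitian)
    {ι : Type*} [Fintype ι] (e : ι → ℝ)
    (h : A.charpoly = ∏ i, (Polynomial.X - Polynomial.C (e i : ℂ))) :
    vonNeumannEntropy A = ∑ i, Real.negMulLog (e i) := by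
  have h1 := hA.roots_charpoly_eq_eigenvalues
  have h2 : A.charpoly.roots = Finset.univ.val.map (fun i => (e i : ℂ)) := by
    rw [h, Polynomial.roots_prod _ _ (Finset.prod_ne_zero_iff.2 fun i _ =>
      Polynomial.X_sub_C_ne_zero _)]
    simp
  rw [h2] at h1
  have h3 := congrArg (fun s => (s.map (fun z : ℂ => Real.negMulLog z.re)).sum) h1
  simp only [Multiset.map_map] at h3
  rw [vonNeumannEntropy_eq_sum_eigenvalues hA]
  exact h3.symm

theorem IsDensityMatrix.sum_eigenvalues {A : Matrix n n ℂ} (hA : IsDensityMatrix A) :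
    ∑ i, hA.posSemidef.1.eigenvalues i = 1 := by
  have := hA.trace_eq_one
  rw [hA.posSemidef.1.trace_eq_sum_eigenvalues] at this
  exact Complex.ofReal_injective (by simpa using this)

theorem vonNeumannEntropy_nonneg {A : Matrix n n ℂ} (hA : IsDensityMatrix A) :
    0 ≤ vonNeumannEntropy A := by
  rw [vonNeumannEntropy_eq_sum_eigenvalues hA.posSemidef.1]
  have h0 := hA.posSemidef.eigenvalues_nonneg
  refine Finset.sum_nonneg fun i _ => Real.negMulLog_nonneg (h0 i) ?_
  rw [← hA.sum_eigenvalues]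
  exact Finset.single_le_sum (f := hA.posSemidef.1.eigenvalues) (fun j _ => h0 j)
    (Finset.mem_univ i)

omit [DecidableEq n] [DecidableEq m] in
theorem IsDensityMatrix.kronecker {A : Matrix n n ℂ} {B : Matrix m m ℂ} (hA : IsDensityMatrix A)
    (hB : IsDensityMatrix B) : IsDensityMatrix (A ⊗ₖ B) :=
  ⟨hA.posSemidef.kronecker hB.posSemidef, by
    rw [trace_kronecker, hA.trace_eq_one, hB.trace_eq_one, one_mul]⟩

/-- The tensor product of the eigenbases diagonalizes `A ⊗ B`. Working with the characteristic
polynomial avoids matching the indexing of its eigenvalues with pairs. -/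
theorem charpoly_kronecker {A : Matrix n n ℂ} {B : Matrix m m ℂ} (hA : A.IsHermitian)
    (hB : B.IsHermitian) :
    (A ⊗ₖ B).charpoly = ∏ x : n × m, (Polynomial.X -
      Polynomial.C ((hA.eigenvalues x.1 * hB.eigenvalues x.2 : ℝ) : ℂ)) := by
  have e : A ⊗ₖ B = ((hA.eigenvectorUnitary : Matrix n n ℂ) ⊗ₖ
      (hB.eigenvectorUnitary : Matrix m m ℂ)) *
      (diagonal (fun x : n × m => ((hA.eigenvalues x.1 * hB.eigenvalues x.2 : ℝ) : ℂ)) *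
      ((hA.eigenvectorUnitary : Matrix n n ℂ)ᴴ ⊗ₖ (hB.eigenvectorUnitary : Matrix m m ℂ)ᴴ)) := by
    conv_lhs => rw [hA.eq_conj_diagonal, hB.eq_conj_diagonal]
    rw [mul_kronecker_mul, mul_kronecker_mul, diagonal_kronecker_diagonal, Matrix.mul_assoc]
    push_cast
    rfl
  rw [e, charpoly_mul_comm, Matrix.mul_assoc, ← mul_kronecker_mul,
    hA.conjTranspose_eigenvectorUnitary_mul, hB.conjTranspose_eigenvectorUnitary_mul,
    one_kronecker_one, Matrix.mul_one, charpoly_diagonal]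

/-- The von Neumann entropy is additive on tensor products of states. -/
theorem vonNeumannEntropy_kronecker {A : Matrix n n ℂ} {B : Matrix m m ℂ}
    (hA : IsDensityMatrix A) (hB : IsDensityMatrix B) :
    vonNeumannEntropy (A ⊗ₖ B) = vonNeumannEntropy A + vonNeumannEntropy B := by
  rw [vonNeumannEntropy_eq_sum_of_charpoly (hA.kronecker hB).posSemidef.1 _
    (charpoly_kronecker hA.posSemidef.1 hB.posSemidef.1),
    vonNeumannEntropy_eq_sum_eigenvalues hA.posSemidef.1,
    vonNeumannEntropy_eq_sum_eigenvalues hB.posSemidef.1, Fintype.sum_prod_type]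
  simp only [Real.negMulLog_mul, Finset.sum_add_distrib, ← Finset.sum_mul, ← Finset.mul_sum,
    hA.sum_eigenvalues, hB.sum_eigenvalues, one_mul]

omit [DecidableEq n] in
theorem isDensityMatrix_sum_smul {ι : Type*} [Fintype ι] {p : ι → ℝ} (hp : ∀ k, 0 ≤ p k)
    (hp1 : ∑ k, p k = 1) {R : ι → Matrix n n ℂ} (hR : ∀ k, IsDensityMatrix (R k)) :
    IsDensityMatrix (∑ k, (p k : ℂ) • R k) := by
  refine ⟨posSemidef_sum _ fun k _ =>
    (hR k).posSemidef.smul (Complex.zero_le_real.2 (hp k)), ?_⟩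
  simp only [trace_sum, trace_smul, (hR _).trace_eq_one, smul_eq_mul, mul_one]
  exact_mod_cast hp1

/-- The Holevo quantity as an average relative entropy. -/
theorem sum_mul_relEntropy {ι : Type*} [Fintype ι] (p : ι → ℝ) (R : ι → Matrix n n ℂ) :
    ∑ k, p k * relEntropy (R k) (∑ l, (p l : ℂ) • R l) =
      vonNeumannEntropy (∑ k, (p k : ℂ) • R k) - ∑ k, p k * vonNeumannEntropy (R k) := by
  have h : vonNeumannEntropy (∑ k, (p k : ℂ) • R k) =
      -∑ k, p k * (R k * cfc Real.log (∑ l, (p l : ℂ) • R l)).trace.re := by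
    rw [vonNeumannEntropy]
    generalize cfc Real.log (∑ k, (p k : ℂ) • R k) = L
    simp [Finset.sum_mul, trace_sum]
  rw [h, neg_sub_left, ← Finset.sum_add_distrib, ← Finset.sum_neg_distrib]
  refine Finset.sum_congr rfl fun k _ => ?_
  rw [relEntropy, vonNeumannEntropy]
  ring

omit [Fintype n] [DecidableEq n] in
-- Supplies the domination hypothesis of `relEntropy_le_of_marginal`: an ensemble average dominates
-- each weighted member.
theorem posSemidef_sum_smul_sub {ι : Type*} [Fintype ι] {p : ι → ℝ} (hp : ∀ k, 0 ≤ p k)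
    {R : ι → Matrix n n ℂ} (hR : ∀ k, (R k).PosSemidef) (k : ι) :
    (∑ l, (p l : ℂ) • R l - (p k : ℂ) • R k).PosSemidef := by
  classical
  rw [← Finset.add_sum_erase _ _ (Finset.mem_univ k), add_sub_cancel_left]
  exact posSemidef_sum _ fun l _ => (hR l).smul (Complex.zero_le_real.2 (hp l))

/-- The entropy of a separable state is at least the entropy of its first marginal plus the average
entropy of the second tensor factors. -/
theorem le_vonNeumannEntropy_sum_kronecker {ι : Type*} [Fintype ι] {p : ι → ℝ}
    (hp : ∀ k, 0 ≤ p k) (hp1 : ∑ k, p k = 1) {R : ι → Matrix n n ℂ}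
    (hR : ∀ k, IsDensityMatrix (R k)) {T : ι → Matrix m m ℂ} (hT : ∀ k, IsDensityMatrix (T k)) :
    vonNeumannEntropy (∑ k, (p k : ℂ) • R k) + ∑ k, p k * vonNeumannEntropy (T k) ≤
      vonNeumannEntropy (∑ k, (p k : ℂ) • (R k ⊗ₖ T k)) := by
  have h1 := sum_mul_relEntropy p R
  have h2 := sum_mul_relEntropy p (fun k => R k ⊗ₖ T k)
  simp only [vonNeumannEntropy_kronecker (hR _) (hT _), mul_add, Finset.sum_add_distrib] at h2
  have hRT := fun k => (hR k).kronecker (hT k)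
  have marg : ∀ (k : ι) (Y : Matrix n n ℂ),
      ((R k ⊗ₖ T k) * (Y ⊗ₖ (1 : Matrix m m ℂ))).trace = (R k * Y).trace := fun k Y => by
    rw [← mul_kronecker_mul, Matrix.mul_one, trace_kronecker, (hT k).trace_eq_one, mul_one]
  have key : ∑ k, p k * relEntropy (R k) (∑ l, (p l : ℂ) • R l) ≤
      ∑ k, p k * relEntropy (R k ⊗ₖ T k) (∑ l, (p l : ℂ) • (R l ⊗ₖ T l)) := by
    refine Finset.sum_le_sum fun k _ => ?_
    rcases (hp k).eq_or_lt with h | h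
    -- Members of weight zero are not dominated by the average, but they do not contribute.
    · simp [← h]
    · refine mul_le_mul_of_nonneg_left (relEntropy_le_of_marginal (hRT k).posSemidef
        (isDensityMatrix_sum_smul hp hp1 hRT).posSemidef (hR k).posSemidef
        (isDensityMatrix_sum_smul hp hp1 hR).posSemidef (marg k) (fun Y => ?_) h
        (posSemidef_sum_smul_sub hp (fun l => (hRT l).posSemidef) k)
        (posSemidef_sum_smul_sub hp (fun l => (hR l).posSemidef) k)) h.le
      simp only [Finset.sum_mul, trace_sum, Matrix.smul_mul, trace_smul, marg]
  rw [h1, h2] at key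
  linarith

end Entropy

/-! ### Separable outputs of entanglement-breaking channels, and bounds on minimal entropy. -/

section Channels

variable {a b c d : Type*} [Fintype a] [DecidableEq a] [Fintype b]
  [Fintype c] [DecidableEq c] [Fintype d]

theorem exists_isDensityMatrix (a : Type*) [Fintype a] [DecidableEq a] [Nonempty a] :
    ∃ ρ : Matrix a a ℂ, IsDensityMatrix ρ := by
  obtain ⟨i⟩ := ‹Nonempty a›
  refine ⟨diagonal (Pi.single i 1), PosSemidef.diagonal ?_, by simp [trace_diagonal]⟩
  exact Pi.single_nonneg.2 zero_le_one

theorem IsChannel.map_isDensityMatrix {Ω : Matrix c c ℂ →ₗ[ℂ] Matrix d d ℂ} (hΩ : IsChannel Ω)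
    {σ : Matrix c c ℂ} (hσ : IsDensityMatrix σ) : IsDensityMatrix (Ω σ) := by
  refine ⟨?_, by rw [hΩ.trace_map, hσ.trace_eq_one]⟩
  -- Plain positivity is complete positivity with a one-dimensional ancilla.
  have h := hΩ.completelyPositive 1 ((1 : Matrix (Fin 1) (Fin 1) ℂ) ⊗ₖ σ)
    (PosSemidef.one.kronecker hσ.posSemidef)
  rw [tensorMap_kronecker] at h
  have e : Ω σ = ((LinearMap.id (R := ℂ) (1 : Matrix (Fin 1) (Fin 1) ℂ)) ⊗ₖ Ω σ).submatrix
      (fun i => ((0 : Fin 1), i)) (fun i => ((0 : Fin 1), i)) := by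
    ext i j
    simp
  rw [e]
  exact h.submatrix _

/-- The unnormalized state `Tr_A ((X ⊗ 1) ρ)` of the second system after the outcome `X` has been
measured on the first one. -/
def measuredState (X : Matrix a a ℂ) (ρ : Matrix (a × c) (a × c) ℂ) : Matrix c c ℂ :=
  Matrix.of fun l l' => ∑ i, ∑ j, X j i * ρ (i, l) (j, l')

/-- The marginal of a bipartite matrix on the first system. -/
def marginal (ρ : Matrix (a × c) (a × c) ℂ) : Matrix a a ℂ :=
  ∑ l, ρ.submatrix (fun i => (i, l)) (fun i => (i, l))

open scoped MatrixOrder in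
-- With `X = B* B`, the measured state is a sum of congruences of `ρ`, by `⟨row k of B| ⊗ 1`.
theorem posSemidef_measuredState {X : Matrix a a ℂ} (hX : X.PosSemidef)
    {ρ : Matrix (a × c) (a × c) ℂ} (hρ : ρ.PosSemidef) : (measuredState X ρ).PosSemidef := by
  obtain ⟨B, rfl⟩ := CStarAlgebra.nonneg_iff_eq_star_mul_self.1 hX.nonneg
  have e : measuredState (star B * B) ρ = ∑ k, (Matrix.of fun (l : c) (x : a × c) =>
      if x.2 = l then B k x.1 else 0) * ρ * (Matrix.of fun (l : c) (x : a × c) =>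
      if x.2 = l then B k x.1 else 0)ᴴ := by
    ext l l'
    simp only [measuredState, Matrix.of_apply, Matrix.sum_apply, Matrix.mul_apply,
      Matrix.star_apply, conjTranspose_apply, Fintype.sum_prod_type, Finset.sum_mul,
      apply_ite star, star_zero, ite_mul, zero_mul, mul_ite, mul_zero, Finset.sum_ite_eq',
      Finset.mem_univ, if_true]
    rw [Finset.sum_comm, Finset.sum_congr rfl fun j _ => Finset.sum_comm, Finset.sum_comm]
    refine Finset.sum_congr rfl fun k _ => Finset.sum_congr rfl fun j _ =>
      Finset.sum_congr rfl fun i _ => ?_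
    ring
  rw [e]
  exact posSemidef_sum _ fun k _ => hρ.mul_mul_conjTranspose_same _

omit [DecidableEq a] [DecidableEq c] in
theorem trace_mul_marginal (X : Matrix a a ℂ) (ρ : Matrix (a × c) (a × c) ℂ) :
    (X * marginal ρ).trace = (measuredState X ρ).trace := by
  simp only [Matrix.trace, diag_apply, Matrix.mul_apply, marginal, measuredState, Matrix.of_apply,
    Matrix.sum_apply, submatrix_apply, Finset.mul_sum]
  rw [Finset.sum_comm]
  refine Finset.sum_congr rfl fun l _ => ?_
  rw [Finset.sum_comm]

theorem trace_mul_nonneg {X ρ : Matrix a a ℂ} (hX : X.PosSemidef) (hρ : ρ.PosSemidef) :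
    0 ≤ (X * ρ).trace := by
  -- A one-point second system exhibits any `ρ` as a marginal.
  have e : marginal (ρ.submatrix (Prod.fst : a × Unit → a) Prod.fst) = ρ := by
    ext i j
    simp [marginal]
  rw [← e, trace_mul_marginal]
  exact (posSemidef_measuredState hX (hρ.submatrix _)).trace_nonneg

omit [DecidableEq a] [DecidableEq c] in
theorem IsDensityMatrix.marginal {ρ : Matrix (a × c) (a × c) ℂ} (hρ : IsDensityMatrix ρ) :
    IsDensityMatrix (marginal ρ) := by
  refine ⟨posSemidef_sum _ fun l _ => hρ.posSemidef.submatrix _, ?_⟩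
  rw [← hρ.trace_eq_one]
  simp only [QChan.marginal, Matrix.trace, diag_apply, Matrix.sum_apply, submatrix_apply,
    Fintype.sum_prod_type]

omit [Fintype b] [Fintype d] in
theorem tensorMap_eq_sum_kronecker {ι : Type*} [Fintype ι] {Φ : Matrix a a ℂ →ₗ[ℂ] Matrix b b ℂ}
    {R : ι → Matrix b b ℂ} {X : ι → Matrix a a ℂ}
    (hΦ : ∀ ρ, Φ ρ = ∑ k, (X k * ρ).trace • R k)
    (Ω : Matrix c c ℂ →ₗ[ℂ] Matrix d d ℂ) (ρ : Matrix (a × c) (a × c) ℂ) :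
    tensorMap Φ Ω ρ = ∑ k, R k ⊗ₖ Ω (measuredState (X k) ρ) := by
  have h1 : ∀ i j, Φ (single i j 1) = ∑ k, X k j i • R k := fun i j => by
    rw [hΦ]
    refine Finset.sum_congr rfl fun k _ => ?_
    rw [trace_mul_comm, trace_single_mul]
    simp
  have h2 : ∀ k, Ω (measuredState (X k) ρ) = ∑ l, ∑ l', (∑ i, ∑ j, X k j i * ρ (i, l) (j, l')) •
      Ω (single l l' 1) := fun k => by
    conv_lhs => rw [matrix_eq_sum_single (measuredState (X k) ρ)]
    simp only [map_sum, ← map_smul, smul_single, smul_eq_mul, mul_one, measuredState,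
      Matrix.of_apply]
  ext ⟨q, s⟩ ⟨q', s'⟩
  simp only [tensorMap, LinearMap.coe_mk, AddHom.coe_mk, h1, h2, Matrix.sum_apply,
    Matrix.smul_apply, kroneckerMap_apply, smul_eq_mul, Fintype.sum_prod_type, Finset.mul_sum,
    Finset.sum_mul]
  -- All five sums are reordered at once, by a bijection of the product index types.
  have := fun (f : a → c → a → c → ι → ℂ) => show
      ∑ i, ∑ l, ∑ j, ∑ l', ∑ k, f i l j l' k = ∑ k, ∑ l, ∑ l', ∑ i, ∑ j, f i l j l' k by
    simp only [← Fintype.sum_prod_type']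
    exact Fintype.sum_equiv ⟨fun x => ⟨x.2.2.2.2, x.2.1, x.2.2.2.1, x.1, x.2.2.1⟩,
      fun x => ⟨x.2.2.2.1, x.2.1, x.2.2.2.2, x.2.2.1, x.1⟩, fun _ => rfl, fun _ => rfl⟩ _ _
      fun _ => rfl
  rw [this]
  refine Finset.sum_congr rfl fun k _ => Finset.sum_congr rfl fun l _ =>
    Finset.sum_congr rfl fun l' _ => Finset.sum_congr rfl fun i _ =>
    Finset.sum_congr rfl fun j _ => ?_
  ring

theorem _root_.Matrix.PosSemidef.exists_eq_smul_isDensityMatrix [Nonempty c] {Y : Matrix c c ℂ}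
    (hY : Y.PosSemidef) :
    ∃ σ, IsDensityMatrix σ ∧ Y = ((Y.trace.re : ℝ) : ℂ) • σ := by
  have ht := hY.trace_nonneg
  have hre : ((Y.trace.re : ℝ) : ℂ) = Y.trace := (Complex.eq_re_of_ofReal_le ht).symm
  rw [hre]
  by_cases h : Y.trace = 0
  · obtain ⟨σ, hσ⟩ := exists_isDensityMatrix c
    -- A positive semidefinite matrix of trace zero vanishes, so any state serves as its
    -- normalization.
    exact ⟨σ, hσ, by rw [h, zero_smul]; exact hY.trace_eq_zero_iff.1 h⟩
  · refine ⟨Y.trace⁻¹ • Y, ⟨hY.smul (inv_nonneg.2 ht), ?_⟩, ?_⟩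
    · rw [trace_smul, smul_eq_mul, inv_mul_cancel₀ h]
    · rw [smul_smul, mul_inv_cancel₀ h, one_smul]

omit [Fintype d] in
/-- An entanglement-breaking channel sends every bipartite state to a separable state
`∑ₖ pₖ Rₖ ⊗ Ω σₖ` whose first marginal is `∑ₖ pₖ Rₖ = Φ τ` for some state `τ`. -/
theorem IsEntanglementBreaking.exists_tensorMap_eq [Nonempty c]
    {Φ : Matrix a a ℂ →ₗ[ℂ] Matrix b b ℂ} (hΦ : IsEntanglementBreaking Φ)
    (Ω : Matrix c c ℂ →ₗ[ℂ] Matrix d d ℂ) {ρ : Matrix (a × c) (a × c) ℂ}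
    (hρ : IsDensityMatrix ρ) :
    ∃ (K : ℕ) (p : Fin K → ℝ) (R : Fin K → Matrix b b ℂ) (σ : Fin K → Matrix c c ℂ)
      (τ : Matrix a a ℂ), (∀ k, 0 ≤ p k) ∧ ∑ k, p k = 1 ∧ (∀ k, IsDensityMatrix (R k)) ∧
      (∀ k, IsDensityMatrix (σ k)) ∧ IsDensityMatrix τ ∧ Φ τ = ∑ k, (p k : ℂ) • R k ∧
      tensorMap Φ Ω ρ = ∑ k, (p k : ℂ) • (R k ⊗ₖ Ω (σ k)) := by
  obtain ⟨K, R, X, hR, hX, hX1, hΦ⟩ := hΦ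
  have hY := fun k => posSemidef_measuredState (hX k) hρ.posSemidef
  choose σ hσ hYσ using fun k => (hY k).exists_eq_smul_isDensityMatrix
  have hre : ∀ k, (((measuredState (X k) ρ).trace.re : ℝ) : ℂ) = (measuredState (X k) ρ).trace :=
    fun k => (Complex.eq_re_of_ofReal_le (hY k).trace_nonneg).symm
  refine ⟨K, fun k => (measuredState (X k) ρ).trace.re, R, σ, marginal ρ,
    fun k => (Complex.le_def.1 (hY k).trace_nonneg).1, ?_, hR, hσ, hρ.marginal, ?_, ?_⟩
  · apply Complex.ofReal_injective
    push_cast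
    simp only [hre]
    simp only [← trace_mul_marginal]
    rw [← trace_sum, ← Finset.sum_mul, hX1, Matrix.one_mul, hρ.marginal.trace_eq_one]
  · simp only [hΦ, trace_mul_marginal, hre]
  · rw [tensorMap_eq_sum_kronecker hΦ]
    refine Finset.sum_congr rfl fun k _ => ?_
    conv_lhs => rw [hYσ k, map_smul, kronecker_smul]

theorem IsEntanglementBreaking.map_isDensityMatrix {Φ : Matrix a a ℂ →ₗ[ℂ] Matrix b b ℂ}
    (hΦ : IsEntanglementBreaking Φ) {ρ : Matrix a a ℂ} (hρ : IsDensityMatrix ρ) :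
    IsDensityMatrix (Φ ρ) := by
  obtain ⟨K, R, X, hR, hX, hX1, hΦ⟩ := hΦ
  have ht := fun k => trace_mul_nonneg (hX k) hρ.posSemidef
  have hre : ∀ k, (((X k * ρ).trace.re : ℝ) : ℂ) = (X k * ρ).trace :=
    fun k => (Complex.eq_re_of_ofReal_le (ht k)).symm
  have := isDensityMatrix_sum_smul (p := fun k => (X k * ρ).trace.re)
    (fun k => (Complex.le_def.1 (ht k)).1) ?_ hR
  · simpa only [hΦ, hre] using this
  · apply Complex.ofReal_injective
    push_cast
    simp only [hre]
    rw [← trace_sum, ← Finset.sum_mul, hX1, Matrix.one_mul, hρ.trace_eq_one]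

omit [DecidableEq a] in
-- Nonnegativity of entropy bounds the set below, as a real `sInf` requires.
theorem minEntropy_le [DecidableEq b] {Φ : Matrix a a ℂ →ₗ[ℂ] Matrix b b ℂ}
    (hΦ : ∀ ρ, IsDensityMatrix ρ → IsDensityMatrix (Φ ρ)) {ρ : Matrix a a ℂ}
    (hρ : IsDensityMatrix ρ) : minEntropy Φ ≤ vonNeumannEntropy (Φ ρ) := by
  refine csInf_le ⟨0, ?_⟩ ⟨ρ, hρ, rfl⟩
  rintro _ ⟨σ, hσ, rfl⟩
  exact vonNeumannEntropy_nonneg (hΦ σ hσ)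

theorem le_minEntropy [Nonempty a] [DecidableEq b] {Φ : Matrix a a ℂ →ₗ[ℂ] Matrix b b ℂ} {s : ℝ}
    (h : ∀ ρ, IsDensityMatrix ρ → s ≤ vonNeumannEntropy (Φ ρ)) : s ≤ minEntropy Φ := by
  obtain ⟨ρ, hρ⟩ := exists_isDensityMatrix a
  refine le_csInf ⟨_, ρ, hρ, rfl⟩ ?_
  rintro _ ⟨σ, hσ, rfl⟩
  exact h σ hσ

end Channels

end QChan

open QChan in
theorem mainTheorem4 {a b c d : Type*}
    [Fintype a] [DecidableEq a] [Nonempty a] [Fintype b] [DecidableEq b]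
    [Fintype c] [DecidableEq c] [Nonempty c] [Fintype d] [DecidableEq d]
    (Φ : Matrix a a ℂ →ₗ[ℂ] Matrix b b ℂ) (Ω : Matrix c c ℂ →ₗ[ℂ] Matrix d d ℂ)
    (hΦ : QChan.IsEntanglementBreaking Φ) (hΩ : QChan.IsChannel Ω) :
    QChan.minEntropy (QChan.tensorMap Φ Ω) = QChan.minEntropy Φ + QChan.minEntropy Ω := by
  have dΦ := fun ρ (hρ : IsDensityMatrix ρ) => hΦ.map_isDensityMatrix hρ
  have dΩ := fun σ (hσ : IsDensityMatrix σ) => hΩ.map_isDensityMatrix hσ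
  have dT : ∀ ρ, IsDensityMatrix ρ → IsDensityMatrix (tensorMap Φ Ω ρ) := fun ρ hρ => by
    obtain ⟨K, p, R, σ, τ, hp, hp1, hR, hσ, -, -, h⟩ := hΦ.exists_tensorMap_eq Ω hρ
    rw [h]
    exact isDensityMatrix_sum_smul hp hp1 fun k => (hR k).kronecker (dΩ _ (hσ k))
  refine le_antisymm ?_ (le_minEntropy fun ρ hρ => ?_)
  -- Product inputs: the two infima are split off one at a time by moving the other term across.
  · rw [← sub_le_iff_le_add]
    refine le_minEntropy fun ρ hρ => ?_
    rw [sub_le_comm]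
    refine le_minEntropy fun σ hσ => ?_
    rw [sub_le_iff_le_add, add_comm, ← vonNeumannEntropy_kronecker (dΦ ρ hρ) (dΩ σ hσ),
      ← tensorMap_kronecker]
    exact minEntropy_le dT (hρ.kronecker hσ)
  · obtain ⟨K, p, R, σ, τ, hp, hp1, hR, hσ, hτ, hΦτ, h⟩ := hΦ.exists_tensorMap_eq Ω hρ
    rw [h]
    refine le_trans ?_ (le_vonNeumannEntropy_sum_kronecker hp hp1 hR fun k => dΩ _ (hσ k))
    rw [← hΦτ]
    -- What remains is that an average of the entropies of `Ω σₖ` is at least their minimum.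
    refine add_le_add (minEntropy_le dΦ hτ) ?_
    calc minEntropy Ω = ∑ k, p k * minEntropy Ω := by rw [← Finset.sum_mul, hp1, one_mul]
      _ ≤ _ := Finset.sum_le_sum fun k _ =>
        mul_le_mul_of_nonneg_left (minEntropy_le dΩ (hσ k)) (hp k)
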